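/- Conventions. Inner products $\langle x,y\rangle$ are linear in $x$; $\otimes$ and $\oplus$ are Hilbert space tensor product and direct sum. Let $K$ be a Pick kernel on a set $\Lambda$, i.e. a nowhere vanishing positive definite kernel such that for every $\lambda_0\in\Lambda$ the kernel $1-\frac{K(\mu,\lambda_0)K(\lambda_0,\lambda)}{K(\mu,\lambda)K(\lambda_0,\lambda_0)}$ is positive definite. Let $\mathfrak H(K)$ be the reproducing kernel Hilbert space of $K$, with kernel functions $k_\lambda=K(\cdot,\lambda)$. Fix $\lambda_0\in\Lambda$, put $\delta=k_{\lambda_0}/\|k_{\lambda_0}\|$, and let $\mathcal B$ be a Hilbert space and $\beta:\Lambda\to\mathcal B$ a map whose range has dense linear span, with $$K(\mu,\lambda)=\frac{\delta(\mu)\overline{\delta(\lambda)}}{1-\langle\beta(\lambda),\beta(\mu)\rangle}\qquad(\mu,\lambda\in\Lambda).$$ Let $B(\lambda):\mathcal B\to\mathbb C$, $B(\lambda)x=\langle x,\beta(\lambda)\rangle$. A function $G:\Lambda\to\mathcal L(\mathcal G',\mathbb C)$ ($\mathcal G'$ a Hilbert space) is a contractive multiplier if $k_\lambda\mapsto G(\lambda)^*1\otimes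 k_\lambda$ extends to a linear contraction $\mathfrak m_G^*:\mathfrak H(K)\to\mathcal G'\otimes\mathfrak H(K)$; then $\mathcal M_G$ is the range of $\mathfrak m_G$ with the range norm $\|f\|=\inf\{\|g\|:\mathfrak m_Gg=f\}$. The complementary subspace $\mathcal M_G^\sharp$ is the unique Hilbert space contractively included in $\mathfrak H(K)$ such that $\|x'+x''\|^2_{\mathfrak H(K)}\le\|x'\|_{\mathcal M_G}^2+\|x''\|_{\mathcal M_G^\sharp}^2$ for all $x'\in\mathcal M_G$, $x''\in\mathcal M_G^\sharp$, and every $x\in\mathfrak H(K)$ has a unique decomposition $x=x'+x''$ of this kind for which equality holds. The function $B$ is a contractive multiplier; write $\bm B=\mathfrak m_B$, so $\bm B^*k_\lambda=\beta(\lambda)\otimes k_\lambda$. Let $J$ be a conjugation (antilinear isometric involution) of $\mathcal B$ and $\bar\beta=J\beta$. Let $\mathcal D(\mathbb B)$ be the Drury--Arveson space: the reproducing kernel Hilbert space on the open unit ball $\mathbb B$ of $\mathcal B$ with kernel $1/(1-\langle\eta,\xi\rangle)$. A set $E\subset\mathbb B$ is a uniqueness set for $\mathcal D(\mathbb B)$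 if $f\in\mathcal D(\mathbb B)$ and $f|_E\equiv0$ imply $f\equiv0$. Theorem. Suppose that $K$ is normalized at $\lambda_0$ (i.e. $\delta\equiv1$) and that the image of $\bar\beta$ is not a uniqueness set for $\mathcal D(\mathbb B)$. Then there is a unitary $$U=\begin{pmatrix}\bm a&\bm b\\ \bm c&\bm d\end{pmatrix}:\mathbb C\oplus\mathcal B\to\mathcal B\oplus\mathbb C$$ with the following properties. For every $\lambda\in\Lambda$ the operator $1-B(\lambda)\bm a$ is invertible, and $G(\lambda)=\bm d+\bm c(1-B(\lambda)\bm a)^{-1}B(\lambda)\bm b$ defines a contractive multiplier $G:\Lambda\to\mathcal L(\mathcal B,\mathbb C)$. The coordinates $\bm a_\eta=L_\eta^*\bm a:\mathbb C\to\mathbb C$, where $L_\eta:\mathbb C\to\mathcal B$, $L_\eta t=t\eta$, satisfy $\bm a_\eta\bm a_{\eta'}=\bm a_{\eta'}\bm a_\eta$ for all $\eta,\eta'\in\mathcal B$. Nevertheless $\bm B^*(\mathcal M_G^\sharp)\not\subset\mathcal B\otimes\mathcal M_G^\sharp$. -/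

import Mathlib

open scoped TensorProduct ComplexConjugate ComplexOrder InnerProductSpace

noncomputable section

namespace PickSpace

universe u v w

/-! ### Hilbert space tensor products -/

/-- The Hilbert space tensor product: the completion of the algebraic tensor product for the inner
product `⟪x ⊗ y, x' ⊗ y'⟫ = ⟪x, x'⟫ ⟪y, y'⟫`. -/
abbrev HilbertTensor (E : Type u) (F : Type v)
    [NormedAddCommGroup E] [InnerProductSpace ℂ E]
    [NormedAddCommGroup F] [InnerProductSpace ℂ F] : Type (max u v) :=
  UniformSpace.Completion (E ⊗[ℂ] F)

/-- The elementary tensor `x ⊗ y` in the Hilbert space tensor product. -/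
def htmul {E : Type u} {F : Type v}
    [NormedAddCommGroup E] [InnerProductSpace ℂ E]
    [NormedAddCommGroup F] [InnerProductSpace ℂ F] (x : E) (y : F) : HilbertTensor E F :=
  ((x ⊗ₜ[ℂ] y : E ⊗[ℂ] F) : UniformSpace.Completion (E ⊗[ℂ] F))

/-- The operator `I ⊗ g` on Hilbert space tensor products. -/
def idTensor (E : Type u) {F : Type v} {F' : Type w}
    [NormedAddCommGroup E] [InnerProductSpace ℂ E]
    [NormedAddCommGroup F] [InnerProductSpace ℂ F]
    [NormedAddCommGroup F'] [InnerProductSpace ℂ F'] (g : F →L[ℂ] F') :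
    HilbertTensor E F →L[ℂ] HilbertTensor E F' :=
  (g.lTensor E).completion

/-! ### Contractively included subspaces and complementary subspaces -/

/-- A Hilbert space contractively included in the Hilbert space `H`: a Hilbert space `space`
identified with a vector subspace of `H` by the injective linear map `incl`, with
`‖incl x‖ ≤ ‖x‖`. -/
structure ContractiveSubspace (H : Type u) [NormedAddCommGroup H] [InnerProductSpace ℂ H] where
  space : Type v
  [normed : NormedAddCommGroup space]
  [inner : InnerProductSpace ℂ space]
  [complete : CompleteSpace space]
  incl : space →L[ℂ] H
  incl_injective : Function.Injective incl
  norm_incl_le : ∀ x, ‖incl x‖ ≤ ‖x‖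

attribute [instance] ContractiveSubspace.normed ContractiveSubspace.inner
  ContractiveSubspace.complete

/-- The underlying vector subspace of `H`. -/
def ContractiveSubspace.carrier {H : Type u} [NormedAddCommGroup H] [InnerProductSpace ℂ H]
    (S : ContractiveSubspace.{u, v} H) : Submodule ℂ H :=
  LinearMap.range S.incl.toLinearMap

/-- The vector subspace `E ⊗ S` of `E ⊗ H`, for `S` contractively included in `H`: the Hilbert
space tensor product of `E` and `S`, viewed inside `E ⊗ H`. -/
def ContractiveSubspace.tensorCarrier {H : Type u} [NormedAddCommGroup H] [InnerProductSpace ℂ H]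
    (E : Type w) [NormedAddCommGroup E] [InnerProductSpace ℂ E]
    (S : ContractiveSubspace.{u, v} H) : Submodule ℂ (HilbertTensor E H) :=
  LinearMap.range (idTensor E S.incl).toLinearMap

/-- `T` is the complementary subspace of `S` in `H`. -/
structure ContractiveSubspace.IsComplementary {H : Type u} [NormedAddCommGroup H]
    [InnerProductSpace ℂ H] (S : ContractiveSubspace.{u, v} H)
    (T : ContractiveSubspace.{u, w} H) : Prop where
  norm_add_sq_le : ∀ (x : S.space) (y : T.space), ‖S.incl x + T.incl y‖ ^ 2 ≤ ‖x‖ ^ 2 + ‖y‖ ^ 2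
  existsUnique_decomposition : ∀ h : H, ∃! p : S.space × T.space,
    S.incl p.1 + T.incl p.2 = h ∧ ‖h‖ ^ 2 = ‖p.1‖ ^ 2 + ‖p.2‖ ^ 2

/-- The range of a contraction `C`, with the range norm `‖x‖ = inf {‖y‖ : C y = x}`, that is, with
the norm that makes `C` unitary from `(ker C)ᗮ` onto its range. -/
def rangeSpace {C : Type v} {H : Type u} [NormedAddCommGroup C] [InnerProductSpace ℂ C]
    [CompleteSpace C] [NormedAddCommGroup H] [InnerProductSpace ℂ H]
    (T : C →L[ℂ] H) (hT : ‖T‖ ≤ 1) : ContractiveSubspace.{u, v} H where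
  space := (LinearMap.ker T.toLinearMap)ᗮ
  incl := T ∘L (LinearMap.ker T.toLinearMap)ᗮ.subtypeL
  incl_injective := by
    rw [injective_iff_map_eq_zero]
    intro x hx
    have h1 : (x : C) ∈ LinearMap.ker T.toLinearMap := by simpa using hx
    have h2 := (Submodule.mem_orthogonal _ _).1 x.2 x h1
    exact Subtype.ext (inner_self_eq_zero.1 h2)
  norm_incl_le x := by
    simpa using T.le_of_opNorm_le hT (x : C)

/-! ### Kernels, multipliers, Pick kernels -/

section Kernels

variable {Λ : Type w} (H : Type u) [NormedAddCommGroup H] [InnerProductSpace ℂ H]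
  [CompleteSpace H] [RKHS ℂ H Λ ℂ]

/-- The function `k_l ∈ H`, for which `f l = ⟨f, k_l⟩`. -/
def ker (l : Λ) : H := RKHS.kerFun H l 1

/-- The reproducing kernel `K (m, l) = k_l m`. -/
def kernel (m l : Λ) : ℂ := ker H l m

/-- The normalization `δ = k_{l₀} / ‖k_{l₀}‖`. -/
def normalizedKer (l₀ : Λ) : H := ((‖ker H l₀‖ : ℂ))⁻¹ • ker H l₀

/-- `H` is normalized at `l₀`: the function `δ` is identically `1`. -/
def IsNormalizedAt (l₀ : Λ) : Prop := ∀ m, normalizedKer H l₀ m = 1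

variable {G' : Type v} [NormedAddCommGroup G'] [InnerProductSpace ℂ G'] [CompleteSpace G']

/-- `T : H → G' ⊗ H` is the adjoint of the operator of multiplication by
`G : Λ → L(G', ℂ)`: it maps `k_l` to `G(l)^* 1 ⊗ k_l`. -/
def IsMultiplierAdjoint (G : Λ → G' →L[ℂ] ℂ) (T : H →L[ℂ] HilbertTensor G' H) : Prop :=
  ∀ l, T (ker H l) = htmul ((G l).adjoint 1) (ker H l)

/-- `G : Λ → L(G', ℂ)` is a contractive multiplier from `G' ⊗ H` to `H`. -/
def IsContractiveMultiplier (G : Λ → G' →L[ℂ] ℂ) : Prop :=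
  ∃ T : H →L[ℂ] HilbertTensor G' H, ‖T‖ ≤ 1 ∧ IsMultiplierAdjoint H G T

variable {H}

/-- The adjoint `m_G^* : H → G' ⊗ H` of the multiplication operator; it is determined by `G`,
see `multiplierAdjoint_unique`. -/
def multiplierAdjoint {G : Λ → G' →L[ℂ] ℂ} (hG : IsContractiveMultiplier H G) :
    H →L[ℂ] HilbertTensor G' H := hG.choose

theorem norm_multiplierAdjoint_le {G : Λ → G' →L[ℂ] ℂ} (hG : IsContractiveMultiplier H G) :
    ‖multiplierAdjoint hG‖ ≤ 1 := hG.choose_spec.1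

theorem multiplierAdjoint_unique {G : Λ → G' →L[ℂ] ℂ} (hG : IsContractiveMultiplier H G)
    (T : H →L[ℂ] HilbertTensor G' H) (hT : IsMultiplierAdjoint H G T) :
    T = multiplierAdjoint hG := by
  refine ContinuousLinearMap.ext_on
    (Submodule.dense_iff_topologicalClosure_eq_top.2 (RKHS.kerFun_dense (𝕜 := ℂ) H)) ?_
  rintro _ ⟨x, v, rfl⟩
  have hv : RKHS.kerFun H x v = v • ker H x := by
    rw [ker, ← map_smul, smul_eq_mul, mul_one]
  rw [hv, map_smul, map_smul, hT x, multiplierAdjoint, hG.choose_spec.2 x]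

/-- The multiplication operator `m_G : G' ⊗ H → H`. -/
def multiplier {G : Λ → G' →L[ℂ] ℂ} (hG : IsContractiveMultiplier H G) :
    HilbertTensor G' H →L[ℂ] H := (multiplierAdjoint hG).adjoint

/-- `M_G`: the range of `m_G` with the range norm. -/
def multiplierRange {G : Λ → G' →L[ℂ] ℂ} (hG : IsContractiveMultiplier H G) :
    ContractiveSubspace.{u, max v u} H :=
  rangeSpace (multiplier hG) (by
    rw [multiplier, LinearIsometryEquiv.norm_map]
    exact norm_multiplierAdjoint_le hG)

end Kernels

/-- A Pick kernel: a (nowhere vanishing) positive definite kernel `K` such that, for every base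
point `l₀`, the kernel `1 - K(m, l₀) K(l₀, l) / (K(m, l) K(l₀, l₀))` is positive definite. -/
structure IsPickKernel {Λ : Type w} (K : Λ → Λ → ℂ) : Prop where
  posSemidef : (Matrix.of K).PosSemidef
  ne_zero : ∀ m l, K m l ≠ 0
  pick : ∀ l₀ : Λ,
    (Matrix.of fun m l => 1 - K m l₀ * K l₀ l / (K m l * K l₀ l₀)).PosSemidef

section Realization

variable {Λ : Type w} (H : Type u) [NormedAddCommGroup H] [InnerProductSpace ℂ H]
  [CompleteSpace H] [RKHS ℂ H Λ ℂ]
  {B : Type v} [NormedAddCommGroup B] [InnerProductSpace ℂ B]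

/-- `β : Λ → B` represents the Pick kernel of `H` with base point `l₀`:
`K(m, l) = δ(m) conj (δ(l)) / (1 - ⟨β(l), β(m)⟩)`, and `β` has dense linear span in `B`.
(The inner product `⟨x, y⟩`, linear in `x`, is Mathlib's `⟪y, x⟫_ℂ`.) -/
structure IsPickRealization (l₀ : Λ) (β : Λ → B) : Prop where
  kernel_eq : ∀ m l, kernel H m l =
    normalizedKer H l₀ m * conj (normalizedKer H l₀ l) / (1 - ⟪β m, β l⟫_ℂ)
  minimal : (Submodule.span ℂ (Set.range β)).topologicalClosure = ⊤

/-- The row `B(l) : B → ℂ`, `B(l) x = ⟨x, β(l)⟩`. -/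
def row (β : Λ → B) (l : Λ) : B →L[ℂ] ℂ := innerSL ℂ (β l)

end Realization

/-! ### The Drury-Arveson space -/

section DruryArveson

variable (B : Type v) [NormedAddCommGroup B] [InnerProductSpace ℂ B]

/-- The Drury-Arveson kernel `1 / (1 - ⟨z, w⟩)` on the open unit ball of `B`. -/
def druryArvesonKernel (z w : Metric.ball (0 : B) 1) : ℂ := 1 / (1 - ⟪(w : B), (z : B)⟫_ℂ)

theorem posSemidef_druryArvesonKernel : (Matrix.of (druryArvesonKernel B)).PosSemidef := by
  have herm : (Matrix.of (druryArvesonKernel B)).IsHermitian := by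
    ext z w
    simp [druryArvesonKernel]
  have hpow : ∀ n : ℕ, (Matrix.of fun z w : Metric.ball (0 : B) 1 =>
      ⟪(w : B), (z : B)⟫_ℂ ^ n).PosSemidef := by
    have hgram : (Matrix.of fun z w : Metric.ball (0 : B) 1 =>
        ⟪(w : B), (z : B)⟫_ℂ).PosSemidef := by
      refine ⟨by ext z w; simp, fun x => ?_⟩
      have h : (x.sum fun i xi => x.sum fun j xj => star xi *
          (Matrix.of fun z w : Metric.ball (0 : B) 1 => ⟪(w : B), (z : B)⟫_ℂ) i j * xj) =
          ⟪x.sum fun i xi => conj xi • (i : B), x.sum fun i xi => conj xi • (i : B)⟫_ℂ := by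
        simp only [Finsupp.sum, sum_inner, inner_sum, inner_smul_left, inner_smul_right,
          Matrix.of_apply, RCLike.star_def, starRingEnd_self_apply]
        refine Finset.sum_congr rfl fun i _ => ?_
        rw [Finset.mul_sum]
        refine Finset.sum_congr rfl fun j _ => ?_
        ring
      rw [h, inner_self_eq_norm_sq_to_K]
      simp
    intro n
    induction n with
    | zero =>
      refine ⟨by ext z w; simp, fun x => ?_⟩
      have h : (x.sum fun i xi => x.sum fun j xj => star xi *
          (Matrix.of fun z w : Metric.ball (0 : B) 1 => ⟪(w : B), (z : B)⟫_ℂ ^ 0) i j * xj) =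
          star (x.sum fun _ xi => xi) * (x.sum fun _ xi => xi) := by
        simp only [Finsupp.sum, Matrix.of_apply, pow_zero, mul_one, star_sum, Finset.sum_mul_sum]
      rw [h]
      exact star_mul_self_nonneg _
    | succ n ih =>
      have h := ih.hadamard hgram
      have h' : (Matrix.of fun z w : Metric.ball (0 : B) 1 => ⟪(w : B), (z : B)⟫_ℂ ^ (n + 1)) =
          Matrix.hadamard (Matrix.of fun z w : Metric.ball (0 : B) 1 => ⟪(w : B), (z : B)⟫_ℂ ^ n)
            (Matrix.of fun z w : Metric.ball (0 : B) 1 => ⟪(w : B), (z : B)⟫_ℂ) := by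
        ext z w
        simp [Matrix.hadamard, pow_succ]
      rw [h']
      exact h
  have hgeom : ∀ z w : Metric.ball (0 : B) 1,
      HasSum (fun n : ℕ => ⟪(w : B), (z : B)⟫_ℂ ^ n) (druryArvesonKernel B z w) := by
    intro z w
    have hz : ‖(z : B)‖ < 1 := mem_ball_zero_iff.1 z.2
    have hw : ‖(w : B)‖ < 1 := mem_ball_zero_iff.1 w.2
    have h : ‖⟪(w : B), (z : B)⟫_ℂ‖ < 1 := by
      refine (norm_inner_le_norm _ _).trans_lt ?_
      nlinarith [norm_nonneg (z : B), norm_nonneg (w : B)]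
    simpa [druryArvesonKernel] using hasSum_geometric_of_norm_lt_one h
  refine ⟨herm, fun x => ?_⟩
  have hsum : HasSum (fun n : ℕ => x.sum fun i xi => x.sum fun j xj => star xi *
      (Matrix.of fun z w : Metric.ball (0 : B) 1 => ⟪(w : B), (z : B)⟫_ℂ ^ n) i j * xj)
      (x.sum fun i xi => x.sum fun j xj => star xi *
        (Matrix.of (druryArvesonKernel B)) i j * xj) :=
    hasSum_sum fun i _ => hasSum_sum fun j _ => ((hgeom i j).mul_left _).mul_right _
  exact hsum.nonneg fun n => (hpow n).2 x

/-- The Drury-Arveson kernel, as a kernel with values in `L(ℂ)`. -/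
def druryArvesonMatrix :
    Matrix (Metric.ball (0 : B) 1) (Metric.ball (0 : B) 1) (ℂ →L[ℂ] ℂ) :=
  Matrix.of fun z w => druryArvesonKernel B z w • ContinuousLinearMap.id ℂ ℂ

instance : Fact (druryArvesonMatrix B).PosSemidef := ⟨by
  have hP := posSemidef_druryArvesonKernel B
  have hH : (druryArvesonMatrix B).IsHermitian := by
    ext z w
    simp [druryArvesonMatrix, druryArvesonKernel, ContinuousLinearMap.star_eq_adjoint,
      ContinuousLinearMap.adjoint_id]
  refine ((RKHS.posSemidef_tfae (K := druryArvesonMatrix B)).out 0 2 rfl rfl).2 ?_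
  refine ⟨hH, fun f => ?_⟩
  have h := (RCLike.nonneg_iff.1 (hP.2 f)).1
  simp only [Finsupp.sum] at h ⊢
  refine h.trans_eq (congrArg _ (Finset.sum_congr rfl fun i _ => ?_))
  refine Finset.sum_congr rfl fun j _ => ?_
  have hK : conj (druryArvesonKernel B j i) = druryArvesonKernel B i j := by
    simp [druryArvesonKernel]
  simp only [druryArvesonMatrix, Matrix.of_apply, smul_apply,
    ContinuousLinearMap.id_apply, smul_eq_mul, RCLike.inner_apply, map_mul, hK, RCLike.star_def]
  ring⟩

/-- The Drury-Arveson space: the reproducing kernel Hilbert space on the open unit ball of `B`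
with the Drury-Arveson kernel. -/
abbrev DruryArveson : Type v := RKHS.OfKernel (druryArvesonMatrix B)

theorem kernel_druryArveson (z w : Metric.ball (0 : B) 1) :
    kernel (DruryArveson B) z w = druryArvesonKernel B z w := by
  rw [kernel, ker, RKHS.kerFun_apply, RKHS.OfKernel.kernel_ofKernel]
  simp [druryArvesonMatrix]

variable {B}

/-- `E` is a uniqueness set for the Drury-Arveson space. -/
def IsUniquenessSet (E : Set (Metric.ball (0 : B) 1)) : Prop :=
  ∀ f : DruryArveson B, (∀ z ∈ E, f z = 0) → f = 0

end DruryArveson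

/-! ### Colligations -/

section Colligation

variable {X : Type*} {G' : Type*} {Y : Type*} {G : Type*}
  [NormedAddCommGroup X] [InnerProductSpace ℂ X] [NormedAddCommGroup G'] [InnerProductSpace ℂ G']
  [NormedAddCommGroup Y] [InnerProductSpace ℂ Y] [NormedAddCommGroup G] [InnerProductSpace ℂ G]

/-- The Hilbert space direct sum `X ⊕ Y`. -/
abbrev DirectSum2 (X Y : Type*) := WithLp 2 (X × Y)

/-- The embedding of the first summand into `X ⊕ Y`. -/
def inclLeft (X Y : Type*) [NormedAddCommGroup X] [InnerProductSpace ℂ X]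
    [NormedAddCommGroup Y] [InnerProductSpace ℂ Y] : X →L[ℂ] DirectSum2 X Y :=
  (WithLp.prodContinuousLinearEquiv 2 ℂ X Y).symm.toContinuousLinearMap ∘L
    ContinuousLinearMap.inl ℂ X Y

/-- The embedding of the second summand into `X ⊕ Y`. -/
def inclRight (X Y : Type*) [NormedAddCommGroup X] [InnerProductSpace ℂ X]
    [NormedAddCommGroup Y] [InnerProductSpace ℂ Y] : Y →L[ℂ] DirectSum2 X Y :=
  (WithLp.prodContinuousLinearEquiv 2 ℂ X Y).symm.toContinuousLinearMap ∘L
    ContinuousLinearMap.inr ℂ X Y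

/-- The entry `a : X → Y` of the matrix of `U : X ⊕ G' → Y ⊕ G`. -/
def blockA (U : DirectSum2 X G' ≃ₗᵢ[ℂ] DirectSum2 Y G) : X →L[ℂ] Y :=
  WithLp.fstL 2 ℂ Y G ∘L (U : DirectSum2 X G' →L[ℂ] DirectSum2 Y G) ∘L inclLeft X G'

/-- The entry `b : G' → Y`. -/
def blockB (U : DirectSum2 X G' ≃ₗᵢ[ℂ] DirectSum2 Y G) : G' →L[ℂ] Y :=
  WithLp.fstL 2 ℂ Y G ∘L (U : DirectSum2 X G' →L[ℂ] DirectSum2 Y G) ∘L inclRight X G'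

/-- The entry `c : X → G`. -/
def blockC (U : DirectSum2 X G' ≃ₗᵢ[ℂ] DirectSum2 Y G) : X →L[ℂ] G :=
  WithLp.sndL 2 ℂ Y G ∘L (U : DirectSum2 X G' →L[ℂ] DirectSum2 Y G) ∘L inclLeft X G'

/-- The entry `d : G' → G`. -/
def blockD (U : DirectSum2 X G' ≃ₗᵢ[ℂ] DirectSum2 Y G) : G' →L[ℂ] G :=
  WithLp.sndL 2 ℂ Y G ∘L (U : DirectSum2 X G' →L[ℂ] DirectSum2 Y G) ∘L inclRight X G'

/-- The value `d + c (I - Z a)⁻¹ Z b` of the transfer function of the colligation `U` at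
`Z : Y → X`. -/
def transferFunction (U : DirectSum2 X G' ≃ₗᵢ[ℂ] DirectSum2 Y G) (Z : Y →L[ℂ] X) : G' →L[ℂ] G :=
  blockD U + blockC U ∘L Ring.inverse (1 - Z ∘L blockA U : X →L[ℂ] X) ∘L Z ∘L blockB U

/-- The coordinate `a_x = L_x^* a : ℂ → ℂ` of `a : ℂ → B = B ⊗ ℂ`, where `L_x : ℂ → B ⊗ ℂ = B` is
the operator `L_x t = x ⊗ t = t x`. -/
def coordinate {B : Type*} [NormedAddCommGroup B] [InnerProductSpace ℂ B] [CompleteSpace B]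
    (a : ℂ →L[ℂ] B) (x : B) : ℂ →L[ℂ] ℂ :=
  (ContinuousLinearMap.toSpanSingleton ℂ x).adjoint ∘L a

end Colligation

end PickSpace

end

/-!
A function `f` in the Drury-Arveson space that vanishes on the image of `J β` does not vanish
identically: choose `α` in the ball of `B` with `f (J α) ≠ 0`. Let `U` be a unitary whose first
column is `(α, s)`, where `s = √(1 - ‖α‖²)`. Its transfer function satisfies
`(1 - G(m) G(l)^*) K(m, l) = g(m) conj (g(l))` with `g = s δ / (1 - ⟨α, β⟩)`, so that
`1 - m_G m_G^* = g ⊗ g` and the complementary subspace of `M_G` is the line `ℂ g`.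

If `B^*` mapped this line into `B ⊗ ℂ g`, then `B^* g = x ⊗ g` for some `x`. The defect of `B^*` is
`δ ⊗ δ`, whence `g (1 - ⟨x, β⟩) = s δ` and `x = α`. The isometry `k_l ↦ conj (δ(l)) κ_{J β(l)}` of
`H` into the Drury-Arveson space, where `κ` denotes the kernel functions, intertwines `B^*` with the
adjoint `S^*` of the row of coordinate multiplications. It maps `g` to a vector `F` with
`S^* F = α ⊗ F`, that is, to a multiple of `κ_{J α}`. But `f` is orthogonal to the range of the
isometry, so `f (J α) = 0`, a contradiction.
-/

noncomputable section

namespace PickSpace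

open InnerProductSpace (rankOne)

universe u v w

section HilbertTensor

variable {E : Type u} {F : Type v} {F' : Type w}
  [NormedAddCommGroup E] [InnerProductSpace ℂ E]
  [NormedAddCommGroup F] [InnerProductSpace ℂ F]
  [NormedAddCommGroup F'] [InnerProductSpace ℂ F']

theorem inner_htmul (x x' : E) (y y' : F) :
    ⟪htmul x y, htmul x' y'⟫_ℂ = ⟪x, x'⟫_ℂ * ⟪y, y'⟫_ℂ := by
  simp [htmul, UniformSpace.Completion.inner_coe]

theorem idTensor_htmul (g : F →L[ℂ] F') (x : E) (y : F) :
    idTensor E g (htmul x y) = htmul x (g y) := by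
  simp [idTensor, htmul]

theorem clm_ext_htmul {f g : HilbertTensor E F →L[ℂ] F'}
    (h : ∀ x y, f (htmul x y) = g (htmul x y)) : f = g := by
  ext t
  induction t using UniformSpace.Completion.induction_on with
  | hp => exact isClosed_eq f.continuous g.continuous
  | ih t =>
    induction t using TensorProduct.induction_on with
    | zero => simp only [UniformSpace.Completion.coe_zero, map_zero]
    | tmul x y => exact h x y
    | add s t hs ht => simp only [UniformSpace.Completion.coe_add, map_add, hs, ht]

/-- The operator `x ↦ x ⊗ y`. -/
def htmulRight (E : Type u) [NormedAddCommGroup E] [InnerProductSpace ℂ E] (y : F) :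
    E →L[ℂ] HilbertTensor E F :=
  LinearMap.mkContinuous
    ((UniformSpace.Completion.toComplL (𝕜 := ℂ)).toLinearMap ∘ₗ (TensorProduct.mk ℂ E F).flip y)
    ‖y‖ fun x => by simp [mul_comm]

@[simp]
theorem htmulRight_apply (x : E) (y : F) : htmulRight E y x = htmul x y := rfl

theorem htmul_smul_right (c : ℂ) (x : E) (y : F) : htmul x (c • y) = c • htmul x y := by
  simp only [htmul, TensorProduct.tmul_smul, UniformSpace.Completion.coe_smul]

theorem htmul_smul_left (c : ℂ) (x : E) (y : F) : htmul (c • x) y = c • htmul x y :=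
  map_smul (htmulRight E y) c x

theorem idTensor_rankOne [CompleteSpace E] (y : F') (z : F) :
    idTensor E (rankOne ℂ y z) = htmulRight E y ∘L (htmulRight E z).adjoint := by
  have adjoint_htmul (x : E) (z' : F) : (htmulRight E z).adjoint (htmul x z') = ⟪z, z'⟫_ℂ • x :=
    ext_inner_left ℂ fun x' => by
      rw [ContinuousLinearMap.adjoint_inner_right, htmulRight_apply, inner_htmul, inner_smul_right,
        mul_comm]
  refine clm_ext_htmul fun x z' => ?_
  rw [idTensor_htmul, InnerProductSpace.rankOne_apply, ContinuousLinearMap.comp_apply,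
    adjoint_htmul, htmulRight_apply, htmul_smul_right, htmul_smul_left]

end HilbertTensor

section DenseSpan

variable {E : Type u} {F : Type v} [NormedAddCommGroup E] [InnerProductSpace ℂ E]
  [NormedAddCommGroup F] [InnerProductSpace ℂ F] {ι : Type*} {u : ι → E}

theorem eq_of_forall_inner_eq (hu : (Submodule.span ℂ (Set.range u)).topologicalClosure = ⊤)
    {x y : E} (h : ∀ i, ⟪u i, x⟫_ℂ = ⟪u i, y⟫_ℂ) : x = y := by
  refine ext_inner_right ℂ fun z => ?_
  have : innerSL ℂ x = innerSL ℂ y :=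
    ContinuousLinearMap.ext_on (Submodule.dense_iff_topologicalClosure_eq_top.2 hu) <| by
      rintro _ ⟨i, rfl⟩
      rw [innerSL_apply_apply, innerSL_apply_apply, ← inner_conj_symm, h, inner_conj_symm]
  exact DFunLike.congr_fun this z

theorem exists_linearIsometry_of_inner_eq [CompleteSpace F]
    (hu : (Submodule.span ℂ (Set.range u)).topologicalClosure = ⊤) {e : ι → F}
    (h : ∀ i j, ⟪e i, e j⟫_ℂ = ⟪u i, u j⟫_ℂ) :
    ∃ V : E →ₗᵢ[ℂ] F, ∀ i, V (u i) = e i := by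
  have norm_eq (c : ι →₀ ℂ) :
      ‖Finsupp.linearCombination ℂ e c‖ = ‖Finsupp.linearCombination ℂ u c‖ := by
    simp only [@norm_eq_sqrt_re_inner ℂ, Finsupp.linearCombination_apply, Finsupp.sum, sum_inner,
      inner_sum, inner_smul_left, inner_smul_right, h]
  have dense : DenseRange (Finsupp.linearCombination ℂ u) := by
    have := Submodule.dense_iff_topologicalClosure_eq_top.2 hu
    rwa [← Finsupp.range_linearCombination] at this
  let V := (Finsupp.linearCombination ℂ e).extendOfNorm (Finsupp.linearCombination ℂ u)
  have V_apply (c : ι →₀ ℂ) :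
      V (Finsupp.linearCombination ℂ u c) = Finsupp.linearCombination ℂ e c :=
    LinearMap.extendOfNorm_eq dense ⟨1, fun c => by rw [norm_eq, one_mul]⟩ c
  refine ⟨⟨V.toLinearMap, fun x => ?_⟩, fun i => ?_⟩
  · refine dense.induction_on x (isClosed_eq V.continuous.norm continuous_norm) fun c => ?_
    exact (congrArg _ (V_apply c)).trans (norm_eq c)
  · simpa using V_apply (Finsupp.single i 1)

end DenseSpan

section ContractiveSubspace

variable {H : Type u} [NormedAddCommGroup H] [InnerProductSpace ℂ H] [CompleteSpace H]

namespace ContractiveSubspace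

variable {S : ContractiveSubspace.{u, v} H} {T : ContractiveSubspace.{u, w} H}

theorem re_inner_adjoint_add_re_inner_adjoint {x : S.space} {y : T.space} {h : H}
    (hxy : S.incl x + T.incl y = h) :
    RCLike.re ⟪x, S.incl.adjoint h⟫_ℂ + RCLike.re ⟪y, T.incl.adjoint h⟫_ℂ = ‖h‖ ^ 2 := by
  rw [ContinuousLinearMap.adjoint_inner_right, ContinuousLinearMap.adjoint_inner_right, ← map_add,
    ← inner_add_left, hxy, inner_self_eq_norm_sq]

theorem eq_adjoint_of_norm_sq_eq {x : S.space} {y : T.space} {h : H}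
    (hle : ‖S.incl.adjoint h‖ ^ 2 + ‖T.incl.adjoint h‖ ^ 2 ≤ ‖h‖ ^ 2)
    (hxy : S.incl x + T.incl y = h) (hn : ‖h‖ ^ 2 = ‖x‖ ^ 2 + ‖y‖ ^ 2) :
    x = S.incl.adjoint h ∧ y = T.incl.adjoint h := by
  have hx := @norm_sub_sq ℂ _ _ _ _ x (S.incl.adjoint h)
  have hy := @norm_sub_sq ℂ _ _ _ _ y (T.incl.adjoint h)
  have hcross := re_inner_adjoint_add_re_inner_adjoint hxy
  have hx0 := sq_nonneg ‖x - S.incl.adjoint h‖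
  have hy0 := sq_nonneg ‖y - T.incl.adjoint h‖
  constructor <;> rw [← sub_eq_zero, ← norm_eq_zero, ← sq_eq_zero_iff] <;> linarith

theorem IsComplementary.norm_adjoint_sq_add_le (hc : S.IsComplementary T) (h : H) :
    ‖S.incl.adjoint h‖ ^ 2 + ‖T.incl.adjoint h‖ ^ 2 ≤ ‖h‖ ^ 2 := by
  set k := S.incl (S.incl.adjoint h) + T.incl (T.incl.adjoint h) with hk
  have hk_inner : RCLike.re ⟪k, h⟫_ℂ = ‖S.incl.adjoint h‖ ^ 2 + ‖T.incl.adjoint h‖ ^ 2 := by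
    rw [hk, inner_add_left, ← S.incl.adjoint_inner_right, ← T.incl.adjoint_inner_right, map_add,
      inner_self_eq_norm_sq, inner_self_eq_norm_sq]
  have hk_norm : ‖k‖ ^ 2 ≤ RCLike.re ⟪k, h⟫_ℂ := hk_inner ▸ hc.norm_add_sq_le _ _
  have hkh := re_inner_le_norm (𝕜 := ℂ) k h
  nlinarith [sq_nonneg (‖k‖ - ‖h‖)]

theorem isComplementary_of_comp_adjoint_add_eq_one
    (h : S.incl ∘L S.incl.adjoint + T.incl ∘L T.incl.adjoint = 1) : S.IsComplementary T := by
  have decomposition (k : H) : S.incl (S.incl.adjoint k) + T.incl (T.incl.adjoint k) = k :=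
    DFunLike.congr_fun h k
  have norm_sq (k : H) : ‖k‖ ^ 2 = ‖S.incl.adjoint k‖ ^ 2 + ‖T.incl.adjoint k‖ ^ 2 := by
    rw [← re_inner_adjoint_add_re_inner_adjoint (decomposition k), inner_self_eq_norm_sq,
      inner_self_eq_norm_sq]
  refine ⟨fun x y => ?_, fun k =>
    ⟨(S.incl.adjoint k, T.incl.adjoint k), ⟨decomposition k, norm_sq k⟩, ?_⟩⟩
  · set k := S.incl x + T.incl y with hk
    have hcross := re_inner_adjoint_add_re_inner_adjoint hk.symm
    have hx := re_inner_le_norm (𝕜 := ℂ) x (S.incl.adjoint k)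
    have hy := re_inner_le_norm (𝕜 := ℂ) y (T.incl.adjoint k)
    have hk_norm := norm_sq k
    nlinarith [sq_nonneg (‖x‖ - ‖S.incl.adjoint k‖), sq_nonneg (‖y‖ - ‖T.incl.adjoint k‖)]
  · rintro ⟨x, y⟩ ⟨hxy, hn⟩
    obtain ⟨hx, hy⟩ := eq_adjoint_of_norm_sq_eq (norm_sq k).ge hxy hn
    exact Prod.ext hx hy

theorem isComplementary_iff :
    S.IsComplementary T ↔ S.incl ∘L S.incl.adjoint + T.incl ∘L T.incl.adjoint = 1 := by
  refine ⟨fun hc => ContinuousLinearMap.ext fun h => ?_,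
    isComplementary_of_comp_adjoint_add_eq_one⟩
  obtain ⟨⟨x, y⟩, ⟨hxy, hn⟩, -⟩ := hc.existsUnique_decomposition h
  obtain ⟨hx, hy⟩ := eq_adjoint_of_norm_sq_eq (hc.norm_adjoint_sq_add_le h) hxy hn
  change S.incl (S.incl.adjoint h) + T.incl (T.incl.adjoint h) = h
  rw [← hx, ← hy, hxy]

end ContractiveSubspace

theorem rangeSpace_incl_comp_adjoint {C : Type v} [NormedAddCommGroup C] [InnerProductSpace ℂ C]
    [CompleteSpace C] (T : C →L[ℂ] H) (hT : ‖T‖ ≤ 1) :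
    (rangeSpace T hT).incl ∘L (rangeSpace T hT).incl.adjoint = T ∘L T.adjoint := by
  let K := LinearMap.ker T.toLinearMap
  have T_comp_starProjection : T ∘L Kᗮ.starProjection = T := by
    ext x
    have : x - Kᗮ.starProjection x ∈ Kᗮᗮ := Submodule.sub_starProjection_mem_orthogonal x
    rw [Submodule.orthogonal_orthogonal, LinearMap.mem_ker, map_sub, sub_eq_zero] at this
    exact this.symm
  change (T ∘L Kᗮ.subtypeL) ∘L (T ∘L Kᗮ.subtypeL).adjoint = _
  rw [ContinuousLinearMap.adjoint_comp, Submodule.adjoint_subtypeL, ContinuousLinearMap.comp_assoc,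
    ← ContinuousLinearMap.comp_assoc Kᗮ.subtypeL, ← ContinuousLinearMap.comp_assoc]
  exact congrArg (· ∘L T.adjoint) T_comp_starProjection

theorem exists_incl_comp_adjoint_eq_rankOne {g : H} (hg : ‖g‖ ≤ 1) :
    ∃ N : ContractiveSubspace.{u, v} H, N.incl ∘L N.incl.adjoint = rankOne ℂ g g := by
  -- A copy of `ℂ` in the universe `v`.
  let e : EuclideanSpace ℂ PUnit.{v + 1} := EuclideanSpace.single PUnit.unit 1
  have he : ‖e‖ = 1 := by simp [e]
  refine ⟨rangeSpace (rankOne ℂ g e) (by rwa [InnerProductSpace.norm_rankOne, he, mul_one]), ?_⟩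
  rw [rangeSpace_incl_comp_adjoint, InnerProductSpace.adjoint_rankOne,
    InnerProductSpace.rankOne_comp_rankOne, inner_self_eq_norm_sq_to_K, he, RCLike.ofReal_one,
    one_pow, one_smul]

namespace ContractiveSubspace

variable {N : ContractiveSubspace.{u, v} H} {g : H}

theorem mem_carrier_of_comp_adjoint_eq_rankOne
    (hN : N.incl ∘L N.incl.adjoint = rankOne ℂ g g) : g ∈ N.carrier := by
  obtain rfl | hg := eq_or_ne g 0
  · exact zero_mem _
  refine ⟨(⟪g, g⟫_ℂ)⁻¹ • N.incl.adjoint g, ?_⟩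
  have : N.incl (N.incl.adjoint g) = ⟪g, g⟫_ℂ • g := DFunLike.congr_fun hN g
  rw [ContinuousLinearMap.coe_coe, map_smul, this, inv_smul_smul₀ (inner_self_ne_zero.2 hg)]

theorem exists_incl_eq_rankOne (hN : N.incl ∘L N.incl.adjoint = rankOne ℂ g g) :
    ∃ n : N.space, N.incl = rankOne ℂ g n := by
  obtain ⟨n, hn : N.incl n = g⟩ := mem_carrier_of_comp_adjoint_eq_rankOne hN
  have adjoint_eq : N.incl.adjoint = rankOne ℂ n g := by
    ext h
    apply N.incl_injective
    rw [InnerProductSpace.rankOne_apply, map_smul, hn]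
    exact DFunLike.congr_fun hN h
  exact ⟨n, by rw [← N.incl.adjoint_adjoint, adjoint_eq, InnerProductSpace.adjoint_rankOne]⟩

theorem exists_eq_htmul_of_mem_tensorCarrier {E : Type w} [NormedAddCommGroup E]
    [InnerProductSpace ℂ E] [CompleteSpace E] (hN : N.incl ∘L N.incl.adjoint = rankOne ℂ g g)
    {t : HilbertTensor E H} (ht : t ∈ N.tensorCarrier E) : ∃ x : E, t = htmul x g := by
  obtain ⟨n, hn⟩ := exists_incl_eq_rankOne hN
  obtain ⟨s, rfl⟩ := ht
  refine ⟨(htmulRight E n).adjoint s, ?_⟩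
  rw [hn, idTensor_rankOne]
  rfl

end ContractiveSubspace

end ContractiveSubspace

section RankOneDefect

variable {E : Type u} {F : Type v} [NormedAddCommGroup E] [InnerProductSpace ℂ E]
  [CompleteSpace E] [NormedAddCommGroup F] [InnerProductSpace ℂ F] [CompleteSpace F]

/-- The defect operator `1 - T^* T` of `T` is the rank one operator `f ↦ ⟪g, f⟫ g` (zero if
`g = 0`). -/
def HasRankOneDefect (T : E →L[ℂ] F) (g : E) : Prop :=
  T.adjoint ∘L T + rankOne ℂ g g = 1

namespace HasRankOneDefect

variable {T : E →L[ℂ] F} {g : E}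

theorem inner_map_map_add (h : HasRankOneDefect T g) (x y : E) :
    ⟪T x, T y⟫_ℂ + ⟪x, g⟫_ℂ * ⟪g, y⟫_ℂ = ⟪x, y⟫_ℂ := by
  have := congrArg (⟪x, ·⟫_ℂ) (DFunLike.congr_fun h y)
  simpa [inner_add_right, inner_smul_right, ContinuousLinearMap.adjoint_inner_right,
    mul_comm] using this

theorem norm_map_sq_add (h : HasRankOneDefect T g) (x : E) :
    ‖T x‖ ^ 2 + ‖⟪g, x⟫_ℂ‖ ^ 2 = ‖x‖ ^ 2 := by
  have := congrArg RCLike.re (h.inner_map_map_add x x)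
  rwa [map_add, inner_self_eq_norm_sq, inner_self_eq_norm_sq, ← inner_conj_symm x g,
    RCLike.conj_mul, ← RCLike.ofReal_pow, RCLike.ofReal_re] at this

theorem norm_le_one (h : HasRankOneDefect T g) : ‖T‖ ≤ 1 := by
  refine T.opNorm_le_bound zero_le_one fun x => ?_
  rw [one_mul, ← sq_le_sq₀ (norm_nonneg _) (norm_nonneg _), ← h.norm_map_sq_add x]
  exact le_add_of_nonneg_right (sq_nonneg _)

theorem norm_vector_le_one (h : HasRankOneDefect T g) : ‖g‖ ≤ 1 := by
  have hg : ‖⟪g, g⟫_ℂ‖ = ‖g‖ ^ 2 := by simp [inner_self_eq_norm_sq_to_K]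
  have := h.norm_map_sq_add g
  rw [hg] at this
  by_contra! hlt
  nlinarith [sq_nonneg ‖T g‖, mul_self_lt_mul_self zero_le_one hlt]

end HasRankOneDefect

end RankOneDefect

section Kernels

variable {Λ : Type w} {H : Type u} [NormedAddCommGroup H] [InnerProductSpace ℂ H]
  [CompleteSpace H] [RKHS ℂ H Λ ℂ]

theorem inner_ker_left (l : Λ) (f : H) : ⟪ker H l, f⟫_ℂ = f l := by
  simp [ker]

theorem inner_ker_ker (m l : Λ) : ⟪ker H m, ker H l⟫_ℂ = kernel H m l := inner_ker_left m _

variable (H) in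
theorem span_ker_dense :
    (Submodule.span ℂ (Set.range (ker H : Λ → H))).topologicalClosure = ⊤ := by
  rw [eq_top_iff, ← RKHS.kerFun_dense (𝕜 := ℂ) H]
  refine Submodule.topologicalClosure_mono (Submodule.span_le.2 ?_)
  rintro _ ⟨l, c, rfl⟩
  have : RKHS.kerFun H l c = c • ker H l := by rw [ker, ← map_smul, smul_eq_mul, mul_one]
  exact this ▸ Submodule.smul_mem _ _ (Submodule.subset_span ⟨l, rfl⟩)

section Multiplier

variable {G' : Type v} [NormedAddCommGroup G'] [InnerProductSpace ℂ G'] [CompleteSpace G']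
  {G : Λ → G' →L[ℂ] ℂ}

theorem multiplierAdjoint_ker (hG : IsContractiveMultiplier H G) (l : Λ) :
    multiplierAdjoint hG (ker H l) = htmul ((G l).adjoint 1) (ker H l) :=
  hG.choose_spec.2 l

theorem exists_hasRankOneDefect_multiplierAdjoint {c : Λ → ℂ}
    (h : ∀ m l, (1 - ⟪(G m).adjoint 1, (G l).adjoint 1⟫_ℂ) * kernel H m l = c m * conj (c l)) :
    ∃ (hG : IsContractiveMultiplier H G) (g : H),
      (∀ l, g l = c l) ∧ HasRankOneDefect (multiplierAdjoint hG) g := by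
  obtain ⟨V, hV⟩ := exists_linearIsometry_of_inner_eq (span_ker_dense H)
    (e := fun l => WithLp.toLp 2 (htmul ((G l).adjoint 1) (ker H l), conj (c l))) fun m l => by
      rw [WithLp.prod_inner_apply, inner_htmul, inner_ker_ker, RCLike.inner_apply, RCLike.conj_conj]
      linear_combination -h m l
  let T : H →L[ℂ] HilbertTensor G' H := WithLp.fstL 2 ℂ _ _ ∘L V.toContinuousLinearMap
  let φ : H →L[ℂ] ℂ := WithLp.sndL 2 ℂ _ _ ∘L V.toContinuousLinearMap
  let g : H := φ.adjoint 1
  have inner_g (f : H) : ⟪g, f⟫_ℂ = φ f := by simp [g, ContinuousLinearMap.adjoint_inner_left]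
  have hTg : HasRankOneDefect T g := by
    refine ContinuousLinearMap.ext fun f => ext_inner_left ℂ fun k => ?_
    have : ⟪T k, T f⟫_ℂ + φ f * conj (φ k) = ⟪k, f⟫_ℂ := V.inner_map_map k f
    simpa [inner_add_right, ContinuousLinearMap.adjoint_inner_right, inner_smul_right,
      ← inner_conj_symm k g, inner_g] using this
  have hT : IsMultiplierAdjoint H G T := fun l => by simp [T, hV]
  have hG : IsContractiveMultiplier H G := ⟨T, hTg.norm_le_one, hT⟩
  refine ⟨hG, g, fun l => ?_, multiplierAdjoint_unique hG T hT ▸ hTg⟩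
  rw [← inner_ker_left, ← inner_conj_symm, inner_g]
  simp [φ, hV]

theorem multiplierRange_incl_comp_adjoint (hG : IsContractiveMultiplier H G) :
    (multiplierRange hG).incl ∘L (multiplierRange hG).incl.adjoint =
      (multiplierAdjoint hG).adjoint ∘L multiplierAdjoint hG := by
  have norm_le : ‖multiplier hG‖ ≤ 1 := by
    rw [multiplier, LinearIsometryEquiv.norm_map]
    exact norm_multiplierAdjoint_le hG
  refine (rangeSpace_incl_comp_adjoint (multiplier hG) norm_le).trans ?_
  rw [multiplier, ContinuousLinearMap.adjoint_adjoint]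

theorem isComplementary_multiplierRange_iff {hG : IsContractiveMultiplier H G} {g : H}
    (hg : HasRankOneDefect (multiplierAdjoint hG) g) (N : ContractiveSubspace H) :
    (multiplierRange hG).IsComplementary N ↔ N.incl ∘L N.incl.adjoint = rankOne ℂ g g := by
  rw [ContractiveSubspace.isComplementary_iff, multiplierRange_incl_comp_adjoint, ← hg,
    add_right_inj]

theorem comp_multiplierAdjoint_eq {Λ' : Type*} {H' : Type*} [NormedAddCommGroup H']
    [InnerProductSpace ℂ H'] [CompleteSpace H'] [RKHS ℂ H' Λ' ℂ] {F : Λ' → G' →L[ℂ] ℂ}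
    (hF : IsContractiveMultiplier H' F) (hG : IsContractiveMultiplier H G) {ζ : Λ → Λ'}
    (hζ : ∀ l, F (ζ l) = G l) {c : Λ → ℂ} {W : H →L[ℂ] H'}
    (hW : ∀ l, W (ker H l) = c l • ker H' (ζ l)) :
    multiplierAdjoint hF ∘L W = idTensor G' W ∘L multiplierAdjoint hG := by
  refine ContinuousLinearMap.ext_on
    (Submodule.dense_iff_topologicalClosure_eq_top.2 (span_ker_dense H)) ?_
  rintro _ ⟨l, rfl⟩
  simp only [ContinuousLinearMap.comp_apply, hW, map_smul, multiplierAdjoint_ker, idTensor_htmul,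
    hζ, htmul_smul_right]

end Multiplier

section Row

variable {B : Type v} [NormedAddCommGroup B] [InnerProductSpace ℂ B] [CompleteSpace B]
  {β : Λ → B}

theorem adjoint_row_one (β : Λ → B) (l : Λ) : (row β l).adjoint 1 = β l := by
  rw [row, ContinuousLinearMap.adjoint_innerSL_apply, ContinuousLinearMap.toSpanSingleton_apply,
    one_smul]

theorem exists_hasRankOneDefect_row {c : Λ → ℂ}
    (h : ∀ m l, kernel H m l * (1 - ⟪β m, β l⟫_ℂ) = c m * conj (c l)) :
    ∃ (hB : IsContractiveMultiplier H (row β)) (d : H),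
      (∀ l, d l = c l) ∧ HasRankOneDefect (multiplierAdjoint hB) d :=
  exists_hasRankOneDefect_multiplierAdjoint fun m l => by
    rw [adjoint_row_one, adjoint_row_one, mul_comm, h]

theorem apply_mul_one_sub_inner_of_multiplierAdjoint_eq
    {hB : IsContractiveMultiplier H (row β)} {d : H}
    (hd : HasRankOneDefect (multiplierAdjoint hB) d) {f : H} {x : B}
    (hf : multiplierAdjoint hB f = htmul x f) (l : Λ) :
    f l * (1 - ⟪β l, x⟫_ℂ) = d l * ⟪d, f⟫_ℂ := by
  have h := hd.inner_map_map_add (ker H l) f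
  rw [multiplierAdjoint_ker, adjoint_row_one, hf, inner_htmul, inner_ker_left, inner_ker_left] at h
  linear_combination -h

end Row

end Kernels

section Colligation

variable {X : Type*} {G' : Type*} {Y : Type*} {G : Type*}
  [NormedAddCommGroup X] [InnerProductSpace ℂ X] [NormedAddCommGroup G'] [InnerProductSpace ℂ G']
  [NormedAddCommGroup Y] [InnerProductSpace ℂ Y] [NormedAddCommGroup G] [InnerProductSpace ℂ G]

theorem apply_toLp_eq_blocks (U : DirectSum2 X G' ≃ₗᵢ[ℂ] DirectSum2 Y G) (x : X) (g : G') :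
    U (WithLp.toLp 2 (x, g)) =
      WithLp.toLp 2 (blockA U x + blockB U g, blockC U x + blockD U g) := by
  have split : WithLp.toLp 2 (x, g) = inclLeft X G' x + inclRight X G' g := by
    simp [inclLeft, inclRight, ← WithLp.toLp_add]
  rw [split, map_add]
  rfl

section Adjoint

variable [CompleteSpace X] [CompleteSpace G'] [CompleteSpace Y] [CompleteSpace G]
  (U : DirectSum2 X G' ≃ₗᵢ[ℂ] DirectSum2 Y G)

/-- The operator `c (I - Z a)⁻¹ : X → G` of the colligation `U` at `Z : Y → X`; it factors the
defect of the transfer function, see `inner_adjoint_transferFunction`. -/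
def resolventRow (Z : Y →L[ℂ] X) : X →L[ℂ] G :=
  blockC U ∘L Ring.inverse (1 - Z ∘L blockA U)

variable {U} in
theorem symm_apply_toLp_resolventRow {Z : Y →L[ℂ] X} (hZ : IsUnit (1 - Z ∘L blockA U)) (y : G) :
    U.symm (WithLp.toLp 2 (Z.adjoint ((resolventRow U Z).adjoint y), y)) =
      WithLp.toLp 2 ((resolventRow U Z).adjoint y, (transferFunction U Z).adjoint y) := by
  refine ext_inner_right ℂ fun p => ?_
  have resolvent_eq (x : X) :
      resolventRow U Z (Z (blockA U x)) + blockC U x = resolventRow U Z x := by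
    have := congrArg (blockC U) (DFunLike.congr_fun (Ring.inverse_mul_cancel _ hZ) x)
    change blockC U (Ring.inverse (1 - Z ∘L blockA U) (x - Z (blockA U x))) = blockC U x at this
    rw [← this, map_sub, map_sub]
    exact add_sub_cancel _ _
  obtain ⟨x, g'⟩ := p
  rw [← U.inner_map_map, U.apply_symm_apply, apply_toLp_eq_blocks, WithLp.prod_inner_apply,
    WithLp.prod_inner_apply]
  simp only [ContinuousLinearMap.adjoint_inner_left, ← inner_add_right]
  rw [map_add, map_add, ← resolvent_eq x]
  congr 1
  simp only [transferFunction, resolventRow, ContinuousLinearMap.comp_apply, add_apply]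
  abel

theorem inner_adjoint_transferFunction {Z W : Y →L[ℂ] X} (hZ : IsUnit (1 - Z ∘L blockA U))
    (hW : IsUnit (1 - W ∘L blockA U)) (y y' : G) :
    ⟪Z.adjoint ((resolventRow U Z).adjoint y), W.adjoint ((resolventRow U W).adjoint y')⟫_ℂ +
        ⟪y, y'⟫_ℂ =
      ⟪(resolventRow U Z).adjoint y, (resolventRow U W).adjoint y'⟫_ℂ +
        ⟪(transferFunction U Z).adjoint y, (transferFunction U W).adjoint y'⟫_ℂ := by
  have := U.symm.inner_map_map
    (WithLp.toLp 2 (Z.adjoint ((resolventRow U Z).adjoint y), y))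
    (WithLp.toLp 2 (W.adjoint ((resolventRow U W).adjoint y'), y'))
  rw [symm_apply_toLp_resolventRow hZ, symm_apply_toLp_resolventRow hW] at this
  exact this.symm

end Adjoint

theorem reflection_orthogonal_sub_eq {v w : X} (hnorm : ‖v‖ = ‖w‖) (hinner : ⟪v, w⟫_ℂ = ⟪w, v⟫_ℂ) :
    (ℂ ∙ (v - w))ᗮ.reflection v = w := by
  have h_sub : (ℂ ∙ (v - w))ᗮ.reflection (v - w) = -(v - w) :=
    Submodule.reflection_orthogonalComplement_singleton_eq_neg _
  have h_add : (ℂ ∙ (v - w))ᗮ.reflection (v + w) = v + w := by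
    refine Submodule.reflection_mem_subspace_eq_self ?_
    rw [Submodule.mem_orthogonal_singleton_iff_inner_left, inner_add_left, inner_sub_right,
      inner_sub_right, hinner, inner_self_eq_norm_sq_to_K, inner_self_eq_norm_sq_to_K, hnorm]
    ring
  have two_smul_eq : (2 : ℂ) • (ℂ ∙ (v - w))ᗮ.reflection v = (2 : ℂ) • w := by
    rw [← map_smul, show (2 : ℂ) • v = (v + w) + (v - w) by module, map_add, h_add, h_sub]
    module
  exact smul_right_injective X two_ne_zero two_smul_eq

variable {B : Type v} [NormedAddCommGroup B] [InnerProductSpace ℂ B]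

theorem exists_colligation_of_norm_sq_add_sq_eq_one {α : B} {s : ℝ} (h : ‖α‖ ^ 2 + s ^ 2 = 1) :
    ∃ U : DirectSum2 ℂ B ≃ₗᵢ[ℂ] DirectSum2 B ℂ,
      blockA U = ContinuousLinearMap.toSpanSingleton ℂ α ∧
        blockC U = ContinuousLinearMap.toSpanSingleton ℂ (s : ℂ) := by
  let v : DirectSum2 B ℂ := WithLp.toLp 2 (0, 1)
  let w : DirectSum2 B ℂ := WithLp.toLp 2 (α, (s : ℂ))
  have hnorm : ‖v‖ = ‖w‖ := by simp [v, w, WithLp.prod_norm_eq_of_L2, h]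
  have hinner : ⟪v, w⟫_ℂ = ⟪w, v⟫_ℂ := by simp [v, w, WithLp.prod_inner_apply]
  let U := (LinearIsometryEquiv.withLpProdComm 2 ℂ ℂ B).trans (ℂ ∙ (v - w))ᗮ.reflection
  have hU : U (inclLeft ℂ B 1) = w := reflection_orthogonal_sub_eq hnorm hinner
  refine ⟨U, ?_, ?_⟩ <;> ext
  · exact (congrArg WithLp.fst hU).trans (one_smul ℂ α).symm
  · exact (congrArg WithLp.snd hU).trans (one_smul ℂ (s : ℂ)).symm

variable {U : DirectSum2 ℂ B ≃ₗᵢ[ℂ] DirectSum2 B ℂ} {α ξ η : B} {s : ℂ}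

theorem isUnit_one_sub_innerSL_comp_blockA
    (hA : blockA U = ContinuousLinearMap.toSpanSingleton ℂ α) (hξ : 1 - ⟪ξ, α⟫_ℂ ≠ 0) :
    IsUnit (1 - innerSL ℂ ξ ∘L blockA U) := by
  have : 1 - innerSL ℂ ξ ∘L blockA U = algebraMap ℂ (ℂ →L[ℂ] ℂ) (1 - ⟪ξ, α⟫_ℂ) := by
    ext
    simp [hA]
  exact this ▸ (IsUnit.mk0 _ hξ).map _

theorem resolventRow_innerSL
    (hA : blockA U = ContinuousLinearMap.toSpanSingleton ℂ α)
    (hC : blockC U = ContinuousLinearMap.toSpanSingleton ℂ s) (hξ : 1 - ⟪ξ, α⟫_ℂ ≠ 0) :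
    resolventRow U (innerSL ℂ ξ) =
      ContinuousLinearMap.toSpanSingleton ℂ (s / (1 - ⟪ξ, α⟫_ℂ)) := by
  refine ((Ring.eq_mul_inverse_iff_mul_eq _ _ _
    (isUnit_one_sub_innerSL_comp_blockA hA hξ)).2 ?_).symm
  ext
  simp [hA, hC, mul_div_cancel₀ _ hξ]

theorem one_sub_inner_adjoint_transferFunction [CompleteSpace B]
    (hA : blockA U = ContinuousLinearMap.toSpanSingleton ℂ α)
    (hC : blockC U = ContinuousLinearMap.toSpanSingleton ℂ s)
    (hξ : 1 - ⟪ξ, α⟫_ℂ ≠ 0) (hη : 1 - ⟪η, α⟫_ℂ ≠ 0) :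
    1 - ⟪(transferFunction U (innerSL ℂ ξ)).adjoint 1,
        (transferFunction U (innerSL ℂ η)).adjoint 1⟫_ℂ =
      s / (1 - ⟪ξ, α⟫_ℂ) * conj (s / (1 - ⟪η, α⟫_ℂ)) * (1 - ⟪ξ, η⟫_ℂ) := by
  have adjoint_one {ζ : B} (hζ : 1 - ⟪ζ, α⟫_ℂ ≠ 0) :
      (resolventRow U (innerSL ℂ ζ)).adjoint 1 = conj (s / (1 - ⟪ζ, α⟫_ℂ)) := by
    rw [resolventRow_innerSL hA hC hζ, ContinuousLinearMap.adjoint_toSpanSingleton,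
      innerSL_apply_apply, RCLike.inner_apply, one_mul]
  have h := inner_adjoint_transferFunction U (isUnit_one_sub_innerSL_comp_blockA hA hξ)
    (isUnit_one_sub_innerSL_comp_blockA hA hη) 1 1
  simp only [adjoint_one hξ, adjoint_one hη, ContinuousLinearMap.adjoint_innerSL_apply,
    ContinuousLinearMap.toSpanSingleton_apply, inner_smul_left, inner_smul_right,
    RCLike.inner_apply (1 : ℂ), RCLike.inner_apply (conj (s / _)), RCLike.conj_conj, map_one,
    one_mul] at h
  linear_combination h

theorem commute_clm_complex (S T : ℂ →L[ℂ] ℂ) : Commute S T := by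
  have apply_eq (R : ℂ →L[ℂ] ℂ) (z : ℂ) : R z = z * R 1 := by
    rw [← smul_eq_mul, ← map_smul, smul_eq_mul, mul_one]
  ext
  change S (T 1) = T (S 1)
  rw [apply_eq S, apply_eq T (S 1), mul_comm]

end Colligation

section Inner

variable {E : Type u} [NormedAddCommGroup E] [InnerProductSpace ℂ E]

theorem one_sub_inner_ne_zero {x y : E} (hx : ‖x‖ < 1) (hy : ‖y‖ < 1) : 1 - ⟪x, y⟫_ℂ ≠ 0 := by
  have norm_inner_lt : ‖⟪x, y⟫_ℂ‖ < 1 := (norm_inner_le_norm x y).trans_lt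
    (mul_lt_one_of_nonneg_of_lt_one_left (norm_nonneg x) hx hy.le)
  intro h
  rw [← sub_eq_zero.1 h, norm_one] at norm_inner_lt
  exact lt_irrefl _ norm_inner_lt

theorem inner_map_map_of_antilinear {F : Type v} [NormedAddCommGroup F] [InnerProductSpace ℂ F]
    {𝓕 : Type*} [FunLike 𝓕 E F] [SemilinearIsometryClass 𝓕 (starRingEnd ℂ) E F] (J : 𝓕) (x y : E) :
    ⟪J x, J y⟫_ℂ = ⟪y, x⟫_ℂ := by
  have re_inner (x y : E) : RCLike.re ⟪J x, J y⟫_ℂ = RCLike.re ⟪x, y⟫_ℂ := by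
    simp only [re_inner_eq_norm_add_mul_self_sub_norm_mul_self_sub_norm_mul_self_div_two, ← map_add,
      SemilinearIsometryClass.norm_map]
  have im_inner := re_inner x (Complex.I • y)
  rw [map_smulₛₗ, inner_smul_right, inner_smul_right] at im_inner
  rw [← inner_conj_symm y x, Complex.ext_iff, Complex.conj_re, Complex.conj_im]
  exact ⟨re_inner x y, by simpa using im_inner⟩

end Inner

section NormalizedKer

variable {Λ : Type w} {H : Type u} [NormedAddCommGroup H] [InnerProductSpace ℂ H]
  [CompleteSpace H] [RKHS ℂ H Λ ℂ]

theorem normalizedKer_mul_conj_base (l₀ m : Λ) :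
    normalizedKer H l₀ m * conj (normalizedKer H l₀ l₀) = kernel H m l₀ := by
  obtain h | h := eq_or_ne (ker H l₀) 0
  · simp [kernel, normalizedKer, h]
  · have base : normalizedKer H l₀ l₀ = ‖ker H l₀‖ := by
      rw [normalizedKer, RKHS.coe_smul, Pi.smul_apply, ← inner_ker_left, inner_self_eq_norm_sq_to_K,
        smul_eq_mul, sq]
      exact inv_mul_cancel_left₀ (by simpa using h) _
    rw [base, Complex.conj_ofReal, normalizedKer, RKHS.coe_smul, Pi.smul_apply, smul_eq_mul,
      mul_right_comm, inv_mul_cancel₀ (by simpa using h), one_mul]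
    rfl

end NormalizedKer

namespace IsPickRealization

variable {Λ : Type w} {H : Type u} [NormedAddCommGroup H] [InnerProductSpace ℂ H]
  [CompleteSpace H] [RKHS ℂ H Λ ℂ] {B : Type v} [NormedAddCommGroup B] [InnerProductSpace ℂ B]
  {l₀ : Λ} {β : Λ → B}

theorem normalizedKer_apply_ne_zero (hβ : IsPickRealization H l₀ β) {l : Λ}
    (hK : kernel H l l ≠ 0) : normalizedKer H l₀ l ≠ 0 := fun h =>
  hK (by rw [hβ.kernel_eq, h, zero_mul, zero_div])

theorem norm_lt_one (hβ : IsPickRealization H l₀ β) {l : Λ} (hK : kernel H l l ≠ 0) :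
    ‖β l‖ < 1 := by
  have hδ : 0 < ‖normalizedKer H l₀ l‖ ^ 2 :=
    pow_pos (norm_pos_iff.2 (hβ.normalizedKer_apply_ne_zero hK)) 2
  have hker : 0 < ‖ker H l‖ ^ 2 := by
    rw [← inner_ker_ker, inner_self_ne_zero] at hK
    exact pow_pos (norm_pos_iff.2 hK) 2
  have norm_ker_sq : ‖ker H l‖ ^ 2 = ‖normalizedKer H l₀ l‖ ^ 2 / (1 - ‖β l‖ ^ 2) := by
    have := hβ.kernel_eq l l
    rw [← inner_ker_ker, inner_self_eq_norm_sq_to_K, inner_self_eq_norm_sq_to_K,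
      RCLike.mul_conj] at this
    exact Complex.ofReal_injective (by push_cast; exact this)
  rw [norm_ker_sq, div_pos_iff_of_pos_left hδ, sub_pos] at hker
  exact (sq_lt_one_iff₀ (norm_nonneg _)).1 hker

theorem kernel_mul_one_sub_inner (hβ : IsPickRealization H l₀ β) (hK : ∀ l, kernel H l l ≠ 0)
    (m l : Λ) :
    kernel H m l * (1 - ⟪β m, β l⟫_ℂ) = normalizedKer H l₀ m * conj (normalizedKer H l₀ l) :=
  (eq_div_iff (one_sub_inner_ne_zero (hβ.norm_lt_one (hK m)) (hβ.norm_lt_one (hK l)))).1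
    (hβ.kernel_eq m l)

theorem apply_base_eq_zero (hβ : IsPickRealization H l₀ β) (hK : ∀ l, kernel H l l ≠ 0) :
    β l₀ = 0 := by
  refine eq_of_forall_inner_eq hβ.minimal fun m => ?_
  have h := hβ.kernel_mul_one_sub_inner hK m l₀
  have kernel_ne_zero : kernel H m l₀ ≠ 0 := by
    rw [← normalizedKer_mul_conj_base]
    exact mul_ne_zero (hβ.normalizedKer_apply_ne_zero (hK m))
      (star_ne_zero.2 (hβ.normalizedKer_apply_ne_zero (hK l₀)))
  rw [normalizedKer_mul_conj_base, mul_eq_left₀ kernel_ne_zero, sub_eq_self] at h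
  rw [h, inner_zero_right]

variable [CompleteSpace B]

theorem exists_hasRankOneDefect_row (hβ : IsPickRealization H l₀ β)
    (hK : ∀ l, kernel H l l ≠ 0) :
    ∃ hB : IsContractiveMultiplier H (row β),
      HasRankOneDefect (multiplierAdjoint hB) (normalizedKer H l₀) := by
  obtain ⟨hB, d, hd, h⟩ := PickSpace.exists_hasRankOneDefect_row (hβ.kernel_mul_one_sub_inner hK)
  exact ⟨hB, (RKHS.ext hd : d = normalizedKer H l₀) ▸ h⟩

variable {U : DirectSum2 ℂ B ≃ₗᵢ[ℂ] DirectSum2 B ℂ} {α : B} {s : ℂ}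

theorem exists_hasRankOneDefect_transferFunction (hβ : IsPickRealization H l₀ β)
    (hK : ∀ l, kernel H l l ≠ 0) (hA : blockA U = ContinuousLinearMap.toSpanSingleton ℂ α)
    (hC : blockC U = ContinuousLinearMap.toSpanSingleton ℂ s)
    (hα : ∀ l, 1 - ⟪β l, α⟫_ℂ ≠ 0) :
    ∃ (hG : IsContractiveMultiplier H fun l => transferFunction U (row β l)) (g : H),
      (∀ l, g l = s / (1 - ⟪β l, α⟫_ℂ) * normalizedKer H l₀ l) ∧
        HasRankOneDefect (multiplierAdjoint hG) g := by
  refine exists_hasRankOneDefect_multiplierAdjoint fun m l => ?_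
  rw [row, row, one_sub_inner_adjoint_transferFunction hA hC (hα m) (hα l), mul_assoc,
    mul_comm (1 - _), hβ.kernel_mul_one_sub_inner hK, map_mul]
  ring

theorem eq_of_multiplierAdjoint_eq_htmul (hβ : IsPickRealization H l₀ β)
    (hK : ∀ l, kernel H l l ≠ 0) {hB : IsContractiveMultiplier H (row β)}
    (hs : s ≠ 0) (hα : ∀ l, 1 - ⟪β l, α⟫_ℂ ≠ 0) {g : H}
    (hg : ∀ l, g l = s / (1 - ⟪β l, α⟫_ℂ) * normalizedKer H l₀ l) {x : B}
    (hx : multiplierAdjoint hB g = htmul x g) : x = α := by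
  obtain ⟨_, hδ⟩ := hβ.exists_hasRankOneDefect_row hK
  have eigen := apply_mul_one_sub_inner_of_multiplierAdjoint_eq hδ hx
  have δ_ne_zero l := hβ.normalizedKer_apply_ne_zero (hK l)
  have inner_δ_g : ⟪normalizedKer H l₀, g⟫_ℂ = s := by
    have := eigen l₀
    rw [hg, hβ.apply_base_eq_zero hK, inner_zero_left, inner_zero_left, sub_zero, div_one, mul_one,
      mul_comm] at this
    exact (mul_left_cancel₀ (δ_ne_zero l₀) this).symm
  refine eq_of_forall_inner_eq hβ.minimal fun l => ?_
  have := eigen l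
  rw [hg, inner_δ_g, mul_right_comm, mul_comm, mul_right_inj' (δ_ne_zero l), div_mul_eq_mul_div,
    div_eq_iff (hα l), mul_right_inj' hs, sub_right_inj] at this
  exact this

theorem exists_colligation (hβ : IsPickRealization H l₀ β) (hK : ∀ l, kernel H l l ≠ 0)
    (hα : ‖α‖ < 1) :
    ∃ U : DirectSum2 ℂ B ≃ₗᵢ[ℂ] DirectSum2 B ℂ, (∀ l, IsUnit (1 - row β l ∘L blockA U)) ∧
      ∃ (hG : IsContractiveMultiplier H fun l => transferFunction U (row β l)) (g : H),
        HasRankOneDefect (multiplierAdjoint hG) g ∧ g ≠ 0 ∧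
          ∀ (hB : IsContractiveMultiplier H (row β)) (x : B),
            multiplierAdjoint hB g = htmul x g → x = α := by
  have hβα (l : Λ) : 1 - ⟪β l, α⟫_ℂ ≠ 0 := one_sub_inner_ne_zero (hβ.norm_lt_one (hK l)) hα
  have defect_pos : 0 < 1 - ‖α‖ ^ 2 := sub_pos.2 ((sq_lt_one_iff₀ (norm_nonneg α)).2 hα)
  obtain ⟨U, hA, hC⟩ := exists_colligation_of_norm_sq_add_sq_eq_one (α := α)
    (s := √(1 - ‖α‖ ^ 2)) (by rw [Real.sq_sqrt defect_pos.le, add_sub_cancel])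
  have hs : (√(1 - ‖α‖ ^ 2) : ℂ) ≠ 0 := Complex.ofReal_ne_zero.2 (Real.sqrt_pos.2 defect_pos).ne'
  obtain ⟨hG, g, hg, hGg⟩ := hβ.exists_hasRankOneDefect_transferFunction hK hA hC hβα
  refine ⟨U, fun l => isUnit_one_sub_innerSL_comp_blockA hA (hβα l), hG, g, hGg, ?_,
    fun _ _ => hβ.eq_of_multiplierAdjoint_eq_htmul hK hs hβα hg⟩
  rintro rfl
  have := hg l₀
  rw [RKHS.coe_zero, Pi.zero_apply, eq_comm, mul_eq_zero] at this
  exact this.elim (div_ne_zero hs (hβα l₀)) (hβ.normalizedKer_apply_ne_zero (hK l₀))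

end IsPickRealization

section DruryArveson

variable {B : Type u} [NormedAddCommGroup B] [InnerProductSpace ℂ B]
  {B' : Type v} [NormedAddCommGroup B'] [InnerProductSpace ℂ B']

theorem kernel_druryArveson_mul_one_sub_inner (z w : Metric.ball (0 : B') 1) :
    kernel (DruryArveson B') z w * (1 - ⟪(w : B'), z⟫_ℂ) = 1 := by
  rw [kernel_druryArveson]
  exact one_div_mul_cancel
    (one_sub_inner_ne_zero (mem_ball_zero_iff.1 w.2) (mem_ball_zero_iff.1 z.2))

theorem exists_apply_ne_zero_of_not_isUniquenessSet {E : Set (Metric.ball (0 : B') 1)}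
    (hE : ¬ IsUniquenessSet E) :
    ∃ f : DruryArveson B', (∀ z ∈ E, f z = 0) ∧ ∃ z, f z ≠ 0 := by
  rw [IsUniquenessSet] at hE
  push Not at hE
  obtain ⟨f, hf, hf_ne⟩ := hE
  refine ⟨f, hf, ?_⟩
  contrapose! hf_ne
  exact RKHS.ext fun z => (hf_ne z).trans (congrFun RKHS.coe_zero z).symm

theorem exists_hasRankOneDefect_row_druryArveson [CompleteSpace B] (J : B ≃ₗᵢ⋆[ℂ] B') :
    ∃ (hS : IsContractiveMultiplier (DruryArveson B')
        (row fun z : Metric.ball (0 : B') 1 => J.symm z)) (e : DruryArveson B'),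
      (∀ z, e z = 1) ∧ HasRankOneDefect (multiplierAdjoint hS) e :=
  exists_hasRankOneDefect_row fun z w => by
    rw [inner_map_map_of_antilinear J.symm, kernel_druryArveson_mul_one_sub_inner, map_one, mul_one]

theorem exists_eq_smul_ker_of_multiplierAdjoint_eq [CompleteSpace B] {J : B ≃ₗᵢ⋆[ℂ] B'}
    {hS : IsContractiveMultiplier (DruryArveson B')
      (row fun z : Metric.ball (0 : B') 1 => J.symm z)}
    {f : DruryArveson B'} {α : Metric.ball (0 : B') 1}
    (hf : multiplierAdjoint hS f = htmul (J.symm α) f) :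
    ∃ c : ℂ, f = c • ker (DruryArveson B') α := by
  obtain ⟨_, e, he, hSe⟩ := exists_hasRankOneDefect_row_druryArveson J
  refine ⟨⟪e, f⟫_ℂ, RKHS.ext fun z => ?_⟩
  have h := apply_mul_one_sub_inner_of_multiplierAdjoint_eq hSe hf z
  rw [he, one_mul, inner_map_map_of_antilinear J.symm] at h
  calc f z = f z * (kernel (DruryArveson B') z α * (1 - ⟪(α : B'), z⟫_ℂ)) := by
        rw [kernel_druryArveson_mul_one_sub_inner, mul_one]
    _ = ⟪e, f⟫_ℂ * kernel (DruryArveson B') z α := by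
        rw [← h]
        ring
    _ = (⟪e, f⟫_ℂ • ker (DruryArveson B') α) z := by
        rw [RKHS.coe_smul]
        rfl

end DruryArveson

namespace IsPickRealization

variable {Λ : Type w} {H : Type u} [NormedAddCommGroup H] [InnerProductSpace ℂ H]
  [CompleteSpace H] [RKHS ℂ H Λ ℂ] {B : Type v} [NormedAddCommGroup B] [InnerProductSpace ℂ B]
  {B' : Type*} [NormedAddCommGroup B'] [InnerProductSpace ℂ B'] {l₀ : Λ} {β : Λ → B}
  {J : B ≃ₗᵢ⋆[ℂ] B'} {ζ : Λ → Metric.ball (0 : B') 1}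

theorem exists_linearIsometry_druryArveson (hβ : IsPickRealization H l₀ β)
    (hζ : ∀ l, ζ l = J (β l)) :
    ∃ V : H →ₗᵢ[ℂ] DruryArveson B',
      ∀ l, V (ker H l) = conj (normalizedKer H l₀ l) • ker (DruryArveson B') (ζ l) := by
  refine exists_linearIsometry_of_inner_eq (span_ker_dense H) fun m l => ?_
  rw [inner_smul_left, inner_smul_right, inner_ker_ker, inner_ker_ker, kernel_druryArveson,
    druryArvesonKernel, hζ, hζ, inner_map_map_of_antilinear J, hβ.kernel_eq, RCLike.conj_conj]
  ring

theorem apply_eq_zero_of_multiplierAdjoint_eq [CompleteSpace B] (hβ : IsPickRealization H l₀ β)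
    (hK : ∀ l, kernel H l l ≠ 0) {hB : IsContractiveMultiplier H (row β)}
    {α : Metric.ball (0 : B') 1} {g : H} (hg_ne : g ≠ 0)
    (hg : multiplierAdjoint hB g = htmul (J.symm α) g) {f : DruryArveson B'}
    (hf : ∀ z : Metric.ball (0 : B') 1, (∃ l, (z : B') = J (β l)) → f z = 0) : f α = 0 := by
  let ζ (l : Λ) : Metric.ball (0 : B') 1 :=
    ⟨J (β l), by simpa using hβ.norm_lt_one (hK l)⟩
  obtain ⟨V, hV⟩ := hβ.exists_linearIsometry_druryArveson (ζ := ζ) fun _ => rfl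
  obtain ⟨hS, -⟩ := exists_hasRankOneDefect_row_druryArveson J
  have Vg_eigenvector : multiplierAdjoint hS (V g) = htmul (J.symm α) (V g) := by
    have := DFunLike.congr_fun (comp_multiplierAdjoint_eq hS hB (ζ := ζ)
      (fun l => congrArg (innerSL ℂ) (J.symm_apply_apply (β l)))
      (W := V.toContinuousLinearMap) hV) g
    simp only [ContinuousLinearMap.comp_apply, hg, idTensor_htmul] at this
    exact this
  obtain ⟨c, hc⟩ := exists_eq_smul_ker_of_multiplierAdjoint_eq Vg_eigenvector
  have hc_ne : c ≠ 0 := by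
    rintro rfl
    exact hg_ne (V.injective (hc.trans ((zero_smul ℂ _).trans (map_zero V).symm)))
  have adjoint_f : V.toContinuousLinearMap.adjoint f = 0 := by
    refine eq_of_forall_inner_eq (span_ker_dense H) fun l => ?_
    rw [ContinuousLinearMap.adjoint_inner_right, inner_zero_right]
    change ⟪V (ker H l), f⟫_ℂ = 0
    rw [hV, inner_smul_left, inner_ker_left, hf _ ⟨l, rfl⟩, mul_zero]
  have inner_Vg_f : ⟪V g, f⟫_ℂ = 0 := by
    have := V.toContinuousLinearMap.adjoint_inner_right g f
    rwa [adjoint_f, inner_zero_right, eq_comm] at this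
  rw [hc, inner_smul_left, inner_ker_left] at inner_Vg_f
  exact (mul_eq_zero.1 inner_Vg_f).resolve_left (star_ne_zero.2 hc_ne)

end IsPickRealization

end PickSpace

end

open PickSpace in
theorem mainTheorem4_general {Λ : Type*} {H : Type*} [NormedAddCommGroup H]
    [InnerProductSpace ℂ H] [CompleteSpace H] [RKHS ℂ H Λ ℂ]
    {B : Type*} [NormedAddCommGroup B] [InnerProductSpace ℂ B] [CompleteSpace B]
    {B' : Type*} [NormedAddCommGroup B'] [InnerProductSpace ℂ B']
    (hK : ∀ l, kernel H l l ≠ 0) {l₀ : Λ} {β : Λ → B} (hβ : IsPickRealization H l₀ β)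
    (J : B ≃ₗᵢ⋆[ℂ] B')
    (hE : ¬ IsUniquenessSet {z : Metric.ball (0 : B') 1 | ∃ l : Λ, (z : B') = J (β l)}) :
    ∃ hB : IsContractiveMultiplier H (row β),
    ∃ U : DirectSum2 ℂ B ≃ₗᵢ[ℂ] DirectSum2 B ℂ,
      (∀ l, IsUnit (1 - row β l ∘L blockA U)) ∧
      (∀ x y : B, Commute (coordinate (blockA U) x) (coordinate (blockA U) y)) ∧
      ∃ hG : IsContractiveMultiplier H (fun l => transferFunction U (row β l)),
        (∃ N : ContractiveSubspace H, (multiplierRange hG).IsComplementary N) ∧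
        ∀ N : ContractiveSubspace H, (multiplierRange hG).IsComplementary N →
          ¬ N.carrier.map (multiplierAdjoint hB).toLinearMap ≤ N.tensorCarrier B := by
  obtain ⟨f, hf, α', hfα'⟩ := exists_apply_ne_zero_of_not_isUniquenessSet hE
  obtain ⟨hB, -⟩ := hβ.exists_hasRankOneDefect_row hK
  obtain ⟨U, hU, hG, g, hGg, hg_ne, eq_of_eigenvector⟩ := hβ.exists_colligation hK
    ((J.symm.norm_map α').trans_lt (mem_ball_zero_iff.1 α'.2))
  refine ⟨hB, U, hU, fun _ _ => commute_clm_complex _ _, hG, ?_, fun N hN hle => hfα' ?_⟩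
  · obtain ⟨N, hN⟩ := exists_incl_comp_adjoint_eq_rankOne hGg.norm_vector_le_one
    exact ⟨N, (isComplementary_multiplierRange_iff hGg N).2 hN⟩
  · rw [isComplementary_multiplierRange_iff hGg] at hN
    obtain ⟨x, hx⟩ := ContractiveSubspace.exists_eq_htmul_of_mem_tensorCarrier hN
      (hle (Submodule.mem_map_of_mem (N.mem_carrier_of_comp_adjoint_eq_rankOne hN)))
    obtain rfl := eq_of_eigenvector hB x hx
    exact hβ.apply_eq_zero_of_multiplierAdjoint_eq hK hg_ne hx hf

theorem mainTheorem4 {Λ : Type*} {H : Type*} [NormedAddCommGroup H] [InnerProductSpace ℂ H]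
    [CompleteSpace H] [RKHS ℂ H Λ ℂ]
    {B : Type*} [NormedAddCommGroup B] [InnerProductSpace ℂ B] [CompleteSpace B]
    (hK : PickSpace.IsPickKernel (PickSpace.kernel H))
    (l₀ : Λ) (hnorm : PickSpace.IsNormalizedAt H l₀)
    (β : Λ → B) (hβ : PickSpace.IsPickRealization H l₀ β)
    (J : B ≃ₗᵢ⋆[ℂ] B) (hJ : ∀ x, J (J x) = x)
    (hE : ¬ PickSpace.IsUniquenessSet
      {z : Metric.ball (0 : B) 1 | ∃ l : Λ, (z : B) = J (β l)}) :
    ∃ hB : PickSpace.IsContractiveMultiplier H (PickSpace.row β),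
    ∃ U : PickSpace.DirectSum2 ℂ B ≃ₗᵢ[ℂ] PickSpace.DirectSum2 B ℂ,
      (∀ l, IsUnit (1 - PickSpace.row β l ∘L
        PickSpace.blockA U)) ∧
      (∀ x y : B, Commute
        (PickSpace.coordinate
          (PickSpace.blockA U) x)
        (PickSpace.coordinate
          (PickSpace.blockA U) y)) ∧
      ∃ hG : PickSpace.IsContractiveMultiplier H (fun l => PickSpace.transferFunction
          U (PickSpace.row β l)),
        (∃ N : PickSpace.ContractiveSubspace H,
          (PickSpace.multiplierRange hG).IsComplementary N) ∧
        ∀ N : PickSpace.ContractiveSubspace H,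
          (PickSpace.multiplierRange hG).IsComplementary N →
            ¬ N.carrier.map (PickSpace.multiplierAdjoint hB).toLinearMap ≤ N.tensorCarrier B := by
  exact mainTheorem4_general (fun l => hK.ne_zero l l) hβ J hE
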